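/- Let $d\ge 2$, and let $F$ and $G$ be probability distributions on $\mathbb R^d$ having everywhere positive Lebesgue densities that are bounded on every bounded subset of $\mathbb R^d$. Let $\mathbf x_1,\mathbf x_2,\dots$ be i.i.d. from $F$ and $\mathbf y_1,\mathbf y_2,\dots$ i.i.d. from $G$, the two sequences being independent, and put $\mathcal X=\{\mathbf x_1,\dots,\mathbf x_n\}$, $\mathcal Y=\{\mathbf y_1,\dots,\mathbf y_m\}$. For $\mathbf u\in\mathbb R^d$ with $\|\mathbf u\|<1$ let $\Phi(\mathbf u,\mathbf s)=\|\mathbf s\|+\langle\mathbf u,\mathbf s\rangle$ (Euclidean norm and inner product). The empirical spatial quantile $Q_{\mathcal X}(\mathbf u)=(Q_{\mathcal X,1}(\mathbf u),\dots,Q_{\mathcal X,d}(\mathbf u))$ is $$Q_{\mathcal X}(\mathbf u)=\arg\min_{Q\in\mathbb R^d}\ \frac1n\sum_{j=1}^n\{\Phi(\mathbf u,\mathbf x_j-Q)-\Phi(\mathbf u,\mathbf x_j)\}$$ (a fixed choice of minimizer in the case of non-uniqueness, which has probability zero when $n\ge3$), and $Q_{\mathcal Y}(\mathbf u)$ is defined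 likewise from $\mathcal Y$. The spatial rank of $\mathbf z\in\mathbb R^d$ with respect to $\mathcal X$ is $n^{-1}\sum_{j:\mathbf x_j\ne\mathbf z}\|\mathbf z-\mathbf x_j\|^{-1}(\mathbf z-\mathbf x_j)$, and likewise for $\mathcal Y$. Let $\mathbf u_1,\dots,\mathbf u_n$ be the spatial ranks of $\mathbf x_1,\dots,\mathbf x_n$ with respect to $\mathcal X$, and let $\mathbf u_{n+1},\dots,\mathbf u_{n+m}$ be the spatial ranks of $\mathbf y_1,\dots,\mathbf y_m$ with respect to $\mathcal Y$. For $r\in(0,1)$ and $i=1,\dots,d$ let $$S^{(r)}_{n,m,i}(\mathcal X,\mathcal Y)=\{(Q_{\mathcal X,i}(\mathbf u_k),Q_{\mathcal Y,i}(\mathbf u_k)):\ 1\le k\le n+m,\ \|\mathbf u_k\|\le r\}\subset\mathbb R^2,$$ and for $\varepsilon>0$ let $L(\varepsilon)$ be the set of points of $\mathbb R^2$ at Euclidean distance less than $\varepsilon$ from the line with slope $1$ and intercept $0$. Let $n=n_N$ and $m=m_N$ tend to infinity, as $N\to\infty$, in such a way that $n/(n+m)\to\lambda\in(0,1)$. Then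 $$\lim_{N\to\infty}P\Bigl(\bigcap_{i=1}^d\bigl[S^{(r)}_{n,m,i}(\mathcal X,\mathcal Y)\subseteq L(\varepsilon)\bigr]\Bigr)=1\qquad\text{for every } r\in(0,1)\text{ and every }\varepsilon>0$$ if and only if $F=G$. -/

import Mathlib

open MeasureTheory ProbabilityTheory Filter Topology

noncomputable section

/-- `Φ(u, s) = ‖s‖ + ⟪u, s⟫` on `ℝ^d` with the Euclidean structure. -/
def quantileLoss {d : ℕ} (u s : EuclideanSpace ℝ (Fin d)) : ℝ :=
  ‖s‖ + inner ℝ u s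

/-- The objective `Q ↦ E {Φ(u, x - Q) - Φ(u, x)}`, where `x` has distribution `F`. -/
def quantileObjective {d : ℕ} (F : Measure (EuclideanSpace ℝ (Fin d)))
    (u Q : EuclideanSpace ℝ (Fin d)) : ℝ :=
  ∫ x, (quantileLoss u (x - Q) - quantileLoss u x) ∂F

/-- `q` minimizes the objective over the whole of `ℝ^d`. -/
def IsSpatialQuantile {d : ℕ} (F : Measure (EuclideanSpace ℝ (Fin d)))
    (u q : EuclideanSpace ℝ (Fin d)) : Prop :=
  ∀ Q, quantileObjective F u q ≤ quantileObjective F u Q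

/-- The spatial quantile `Q_F(u)`, the arg min of the objective. For `‖u‖ < 1` and a
probability measure `F` a minimizer exists, and it is unique unless `F` is carried by a line
(in particular it is almost surely unique for samples of size at least three from a
distribution with a density, `d ≥ 2`); on a line with ties, this is one fixed minimizer. -/
def spatialQuantile {d : ℕ} (F : Measure (EuclideanSpace ℝ (Fin d)))
    (u : EuclideanSpace ℝ (Fin d)) : EuclideanSpace ℝ (Fin d) :=
  Classical.epsilon (IsSpatialQuantile F u)

/-- The empirical distribution of the data `x_1, …, x_n`. -/
def empiricalDistribution {d n : ℕ} (x : Fin n → EuclideanSpace ℝ (Fin d)) :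
    Measure (EuclideanSpace ℝ (Fin d)) :=
  (n : ENNReal)⁻¹ • ∑ i, Measure.dirac (x i)

/-- The empirical spatial quantile of the data `x_1, …, x_n`. -/
def empiricalSpatialQuantile {d n : ℕ} (x : Fin n → EuclideanSpace ℝ (Fin d))
    (u : EuclideanSpace ℝ (Fin d)) : EuclideanSpace ℝ (Fin d) :=
  spatialQuantile (empiricalDistribution x) u

open Classical in
/-- The spatial rank of `z` with respect to the data `x_1, …, x_n`. -/
def spatialRank {d n : ℕ} (x : Fin n → EuclideanSpace ℝ (Fin d))
    (z : EuclideanSpace ℝ (Fin d)) : EuclideanSpace ℝ (Fin d) :=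
  (n : ℝ)⁻¹ • ∑ i with x i ≠ z, ‖z - x i‖⁻¹ • (z - x i)

/-- The `n + m` spatial ranks of the observations, each within its own data set. -/
def pooledRank {d n m : ℕ} (x : Fin n → EuclideanSpace ℝ (Fin d))
    (y : Fin m → EuclideanSpace ℝ (Fin d)) : Fin n ⊕ Fin m → EuclideanSpace ℝ (Fin d) :=
  Sum.elim (fun k => spatialRank x (x k)) (fun k => spatialRank y (y k))

/-- The `i`-th two-sample Q-Q plot: the points `(Q_{X,i}(u_k), Q_{Y,i}(u_k))` in the plane for
those pooled ranks `u_k` that lie in the closed ball of radius `r` around the origin. -/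
def qqPlot {d n m : ℕ} (r : ℝ) (x : Fin n → EuclideanSpace ℝ (Fin d))
    (y : Fin m → EuclideanSpace ℝ (Fin d)) (i : Fin d) : Set (EuclideanSpace ℝ (Fin 2)) :=
  {p | ∃ k, pooledRank x y k ∈ Metric.closedBall 0 r ∧
    p = !₂[empiricalSpatialQuantile x (pooledRank x y k) i,
           empiricalSpatialQuantile y (pooledRank x y k) i]}

/-- The `ε`-neighborhood of the line with slope `1` and intercept `0` in the plane. -/
def lineNeighborhood (ε : ℝ) : Set (EuclideanSpace ℝ (Fin 2)) :=
  Metric.thickening ε {p | p 1 = p 0}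

/-- `F` has a positive Lebesgue density that is bounded on every bounded subset of `ℝ^d`. -/
def HasPositiveLocallyBoundedDensity {d : ℕ}
    (F : Measure (EuclideanSpace ℝ (Fin d))) : Prop :=
  ∃ f : EuclideanSpace ℝ (Fin d) → ℝ, Measurable f ∧ (∀ x, 0 < f x) ∧
    (∀ s, Bornology.IsBounded s → ∃ C, ∀ x ∈ s, f x ≤ C) ∧
    F = volume.withDensity fun x => ENNReal.ofReal (f x)

end

/-! Put φ_F(Q) = E(‖x - Q‖ - ‖x‖), a convex function. The quantile objective is φ_F(Q) - ⟪u, Q⟫, so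
`Q_F(u)` is the point where φ_F has gradient u, and the spatial rank of a point is a subgradient of
the empirical potential there. The theorem thus asks whether these tilted minimizers are stable
under sampling and whether they determine F.

Stability: by the weak law and a common Lipschitz bound, empirical potentials converge locally
uniformly in probability. Full support and d ≥ 2 make the limiting minimizer unique, so empirical
quantiles converge, locally uniformly in the level (`eventually_tiltedMinimizer_near`). If F = G,
compactness of ‖u‖ ≤ r brings the two quantile maps uniformly close there, whatever the random
levels are.

Determination: ∫ (1 - cos ⟪y, ξ⟫) / ‖ξ‖^(d+1) dξ is a constant times ‖y‖. Integrating the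
characteristic function of F against this kernel and an exponential therefore gives second
differences of φ_F, and Fourier inversion recovers F (`eq_of_normPotential_eq`). If F ≠ G, the
gradients of φ_F and φ_G differ at some p, and the level u = ∇φ_F(p), of norm less than 1, has
distinct quantiles (`exists_tiltedMinimizer_ne`). With high probability some observation falls near
p; its rank is near u (`exists_eventually_tilt_near`), and its plotted point leaves the strip in
some coordinate. -/

/-! ### The norm potential of a measure -/

section Potential

/-- The convex potential `Q ↦ ∫ (‖x - Q‖ - ‖x‖) dμ(x)`, whose gradient is the spatial rank. -/
noncomputable def normPotential {E : Type*} [NormedAddCommGroup E] [MeasurableSpace E]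
    (μ : Measure E) (Q : E) : ℝ :=
  ∫ x, (‖x - Q‖ - ‖x‖) ∂μ

@[simp] theorem normPotential_zero {E : Type*} [NormedAddCommGroup E] [MeasurableSpace E]
    (μ : Measure E) : normPotential μ 0 = 0 := by
  simp [normPotential]

theorem abs_norm_sub_sub_norm_le {E : Type*} [NormedAddCommGroup E] (x Q : E) :
    |‖x - Q‖ - ‖x‖| ≤ ‖Q‖ := by
  have := abs_norm_sub_norm_le (x - Q) x
  simpa using this

/-- A convex function lies above its tangent plane. -/
theorem ConvexOn.add_fderiv_le {E : Type*} [NormedAddCommGroup E] [NormedSpace ℝ E]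
    {f : E → ℝ} (hf : ConvexOn ℝ Set.univ f) {q : E} (hd : DifferentiableAt ℝ f q) (Q : E) :
    f q + fderiv ℝ f q (Q - q) ≤ f Q := by
  have hl := (hd.hasFDerivAt.hasLineDerivAt (Q - q)).tendsto_slope_zero_right
  have : fderiv ℝ f q (Q - q) ≤ f Q - f q := by
    refine le_of_tendsto hl ?_
    filter_upwards [Ioo_mem_nhdsGT (show (0 : ℝ) < 1 by norm_num)] with t ht
    have h := hf.2 (Set.mem_univ q) (Set.mem_univ Q) (show 0 ≤ 1 - t by linarith [ht.2])
      ht.1.le (by ring)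
    have e : (1 - t) • q + t • Q = q + t • (Q - q) := by module
    rw [e, smul_eq_mul, smul_eq_mul] at h
    rw [smul_eq_mul, inv_mul_le_iff₀ ht.1]
    linarith
  linarith

variable {E : Type*} [NormedAddCommGroup E] [InnerProductSpace ℝ E] [FiniteDimensional ℝ E]
  [MeasurableSpace E] [BorelSpace E]

theorem integrable_norm_sub_sub_norm (μ : Measure E) [IsFiniteMeasure μ] (Q : E) :
    Integrable (fun x => ‖x - Q‖ - ‖x‖) μ :=
  Integrable.of_bound (C := ‖Q‖) (by fun_prop)
    (Eventually.of_forall fun x => abs_norm_sub_sub_norm_le x Q)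

theorem normPotential_sub (μ : Measure E) [IsFiniteMeasure μ] (Q Q' : E) :
    normPotential μ Q - normPotential μ Q' = ∫ x, (‖x - Q‖ - ‖x - Q'‖) ∂μ := by
  unfold normPotential
  rw [← integral_sub (integrable_norm_sub_sub_norm μ Q) (integrable_norm_sub_sub_norm μ Q')]
  congr 1 with x
  ring

theorem integrable_norm_sub_sub_norm_sub (μ : Measure E) [IsFiniteMeasure μ] (Q Q' : E) :
    Integrable (fun x => ‖x - Q‖ - ‖x - Q'‖) μ := by
  refine ((integrable_norm_sub_sub_norm μ Q).sub (integrable_norm_sub_sub_norm μ Q')).congr ?_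
  exact Eventually.of_forall fun x => by simp

theorem normPotential_sub_le (μ : Measure E) [IsProbabilityMeasure μ] (Q Q' : E) :
    normPotential μ Q - normPotential μ Q' ≤ ‖Q - Q'‖ := by
  rw [normPotential_sub]
  calc _ ≤ ∫ _, ‖Q - Q'‖ ∂μ := by
        refine integral_mono (integrable_norm_sub_sub_norm_sub μ Q Q') (integrable_const _) ?_
        intro x
        have := norm_sub_norm_le (x - Q) (x - Q')
        simpa [norm_sub_rev] using this
    _ = _ := by simp

theorem abs_normPotential_sub_le (μ : Measure E) [IsProbabilityMeasure μ] (Q Q' : E) :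
    |normPotential μ Q - normPotential μ Q'| ≤ ‖Q - Q'‖ := by
  rw [abs_le]
  have h1 := normPotential_sub_le μ Q Q'
  have h2 := normPotential_sub_le μ Q' Q
  rw [norm_sub_rev] at h2
  constructor <;> linarith

theorem continuous_normPotential (μ : Measure E) [IsProbabilityMeasure μ] :
    Continuous (normPotential μ) := by
  refine (LipschitzWith.of_dist_le_mul (K := 1) fun Q Q' => ?_).continuous
  simpa [dist_eq_norm] using abs_normPotential_sub_le μ Q Q'

theorem convexOn_normPotential (μ : Measure E) [IsFiniteMeasure μ] :
    ConvexOn ℝ Set.univ (normPotential μ) := by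
  refine ⟨convex_univ, fun Q _ Q' _ a b ha hb hab => ?_⟩
  simp only [normPotential, smul_eq_mul, ← integral_const_mul]
  rw [← integral_add ((integrable_norm_sub_sub_norm μ Q).const_mul a)
    ((integrable_norm_sub_sub_norm μ Q').const_mul b)]
  refine integral_mono (integrable_norm_sub_sub_norm μ _)
    (((integrable_norm_sub_sub_norm μ Q).const_mul a).add
      ((integrable_norm_sub_sub_norm μ Q').const_mul b)) fun x => ?_
  have hx : x - (a • Q + b • Q') = a • (x - Q) + b • (x - Q') := by
    rw [smul_sub, smul_sub, sub_add_sub_comm, ← add_smul, hab, one_smul]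
  have h := norm_add_le (a • (x - Q)) (b • (x - Q'))
  rw [← hx, norm_smul, norm_smul, Real.norm_of_nonneg ha, Real.norm_of_nonneg hb] at h
  have : ‖x‖ = a * ‖x‖ + b * ‖x‖ := by rw [← add_mul, hab, one_mul]
  simp only
  linarith

/-- For `c < 1` the potential eventually dominates `c ‖Q‖`, up to an additive constant. -/
theorem exists_le_normPotential (μ : Measure E) [IsProbabilityMeasure μ] {c : ℝ} (hc : c < 1) :
    ∃ K, ∀ Q, c * ‖Q‖ - K ≤ normPotential μ Q := by
  have hlim : Tendsto (fun k : ℕ => μ.real (Metric.closedBall (0 : E) k)) atTop (𝓝 1) := by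
    have h := tendsto_measure_iUnion_atTop (μ := μ)
      (s := fun k : ℕ => Metric.closedBall (0 : E) k)
      (fun a b hab => Metric.closedBall_subset_closedBall (by exact_mod_cast hab))
    rw [Metric.iUnion_closedBall_nat, measure_univ] at h
    simpa [Measure.real, Function.comp_def] using (ENNReal.tendsto_toReal ENNReal.one_ne_top).comp h
  -- The integrand is at least ‖Q‖ - 2k on the ball B of radius k and at least -‖Q‖ off it.
  -- Integrating gives (2μ(B) - 1)‖Q‖ - 2kμ(B), and μ(B) > (1 + c)/2 makes the slope exceed c.
  obtain ⟨k, hk⟩ := (hlim.eventually (lt_mem_nhds (show (1 + c) / 2 < 1 by linarith))).exists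
  refine ⟨2 * k, fun Q => ?_⟩
  set B := Metric.closedBall (0 : E) k
  have hB : MeasurableSet B := Metric.isClosed_closedBall.measurableSet
  have hintegrable : Integrable (B.indicator fun _ => 2 * ‖Q‖ - 2 * (k : ℝ)) μ :=
    (integrable_const _).indicator hB
  have hle : ∫ x, (B.indicator (fun _ => 2 * ‖Q‖ - 2 * (k : ℝ)) x - ‖Q‖) ∂μ
      ≤ normPotential μ Q := by
    refine integral_mono (hintegrable.sub (integrable_const _)) (integrable_norm_sub_sub_norm μ Q) ?_
    intro x
    by_cases hx : x ∈ B
    · have hxk : ‖x‖ ≤ k := by simpa [B] using hx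
      have := norm_sub_norm_le Q x
      rw [norm_sub_rev] at this
      simp only [Set.indicator_of_mem hx]
      linarith
    · have := (abs_le.1 (abs_norm_sub_sub_norm_le x Q)).1
      simp only [Set.indicator_of_notMem hx]
      linarith
  rw [integral_sub hintegrable (integrable_const _), integral_indicator_const _ hB] at hle
  simp only [integral_const, probReal_univ, smul_eq_mul, one_mul] at hle
  have h1 : μ.real B ≤ 1 := measureReal_le_one
  have h2 : (0 : ℝ) ≤ k := Nat.cast_nonneg k
  nlinarith [norm_nonneg Q]

/-- A slope c strictly between ‖u‖ and 1 in the growth bound beats the linear tilt, so the objective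
is coercive. -/
theorem exists_forall_normPotential_sub_inner_le (μ : Measure E) [IsProbabilityMeasure μ]
    {u : E} (hu : ‖u‖ < 1) :
    ∃ q, ∀ Q, normPotential μ q - inner ℝ u q ≤ normPotential μ Q - inner ℝ u Q := by
  have hcont := continuous_normPotential μ
  refine Continuous.exists_forall_le (f := fun Q => normPotential μ Q - inner ℝ u Q)
    (by fun_prop) ?_
  obtain ⟨K, hK⟩ := exists_le_normPotential μ (show (1 + ‖u‖) / 2 < 1 by linarith)
  have hbase : Tendsto (fun Q : E => (1 - ‖u‖) / 2 * ‖Q‖ - K) (cocompact E) atTop :=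
    tendsto_atTop_add_const_right _ _
      ((tendsto_norm_cocompact_atTop (E := E)).const_mul_atTop (by linarith))
  refine tendsto_atTop_mono (fun Q => ?_) hbase
  have := hK Q
  have h2 := real_inner_le_norm u Q
  nlinarith

/-- The minimizer is unique when the measure charges every open set and the space has
dimension at least two. -/
theorem normPotential_sub_inner_lt_of_ne (hE : 2 ≤ Module.finrank ℝ E) (μ : Measure E)
    [IsProbabilityMeasure μ] [μ.IsOpenPosMeasure] {u q : E}
    (hq : ∀ Q, normPotential μ q - inner ℝ u q ≤ normPotential μ Q - inner ℝ u Q)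
    {p : E} (hp : p ≠ q) :
    normPotential μ q - inner ℝ u q < normPotential μ p - inner ℝ u p := by
  refine lt_of_le_of_ne (hq p) fun heq => ?_
  -- If p tied with q, the midpoint c could do no better, so the nonnegative midpoint defect would
  -- integrate to 0; by continuity and full support it would vanish at every x.
  set c : E := (2⁻¹ : ℝ) • (p + q) with hc
  have hnn : ∀ x : E, 0 ≤ (‖x - p‖ - ‖x - c‖) + (‖x - q‖ - ‖x - c‖) := by
    intro x
    have h := norm_add_le (x - p) (x - q)
    have : x - p + (x - q) = (2 : ℝ) • (x - c) := by rw [hc]; module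
    rw [this, norm_smul] at h
    norm_num at h
    linarith
  have hintegrable := (integrable_norm_sub_sub_norm_sub μ p c).add
    (integrable_norm_sub_sub_norm_sub μ q c)
  have hzero : ∫ x, ((‖x - p‖ - ‖x - c‖) + (‖x - q‖ - ‖x - c‖)) ∂μ = 0 := by
    refine le_antisymm ?_ (integral_nonneg hnn)
    rw [integral_add (integrable_norm_sub_sub_norm_sub μ p c)
      (integrable_norm_sub_sub_norm_sub μ q c), ← normPotential_sub, ← normPotential_sub]
    have h := hq c
    have hic : inner ℝ u c = 2⁻¹ * (inner ℝ u p + inner ℝ u q) := by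
      rw [hc, inner_smul_right, inner_add_right]
    linarith
  have hae := (integral_eq_zero_iff_of_nonneg hnn hintegrable).1 hzero
  have hfun := (Continuous.ae_eq_iff_eq μ (by fun_prop) (by fun_prop)).1 hae
  -- Dimension at least two provides v ≠ 0 orthogonal to p - q; at x = c + v both distances to p and
  -- q strictly exceed ‖v‖, so the defect is positive.
  obtain ⟨v, hv, hv0⟩ : ∃ v ∈ (ℝ ∙ (p - q))ᗮ, v ≠ 0 := by
    refine Submodule.exists_mem_ne_zero_of_ne_bot fun hbot => ?_
    have h1 := Submodule.finrank_add_finrank_orthogonal (ℝ ∙ (p - q))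
    have h2 := finrank_span_singleton (K := ℝ) (sub_ne_zero.2 hp)
    rw [hbot, finrank_bot, h2] at h1
    omega
  have horth : inner ℝ (p - q) v = 0 := Submodule.mem_orthogonal_singleton_iff_inner_right.1 hv
  have hx := congrFun hfun (c + v)
  simp only [Pi.zero_apply, add_sub_cancel_left] at hx
  have e1 : c + v - p = v - (2⁻¹ : ℝ) • (p - q) := by rw [hc]; module
  have e2 : c + v - q = v + (2⁻¹ : ℝ) • (p - q) := by rw [hc]; module
  rw [e1, e2] at hx
  have horth' : inner ℝ v ((2⁻¹ : ℝ) • (p - q)) = 0 := by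
    rw [inner_smul_right, real_inner_comm, horth, mul_zero]
  have n1 := norm_sub_sq_real v ((2⁻¹ : ℝ) • (p - q))
  have n2 := norm_add_sq_real v ((2⁻¹ : ℝ) • (p - q))
  rw [horth'] at n1 n2
  have hpos : 0 < ‖(2⁻¹ : ℝ) • (p - q)‖ := by
    rw [norm_pos_iff]
    exact smul_ne_zero (by norm_num) (sub_ne_zero.2 hp)
  have l1 : ‖v‖ < ‖v - (2⁻¹ : ℝ) • (p - q)‖ :=
    lt_of_pow_lt_pow_left₀ 2 (norm_nonneg _) (by nlinarith)
  have l2 : ‖v‖ < ‖v + (2⁻¹ : ℝ) • (p - q)‖ :=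
    lt_of_pow_lt_pow_left₀ 2 (norm_nonneg _) (by nlinarith)
  linarith

/-- The integrand is 1-Lipschitz in Q and differentiable except at Q = x, a null event for a measure
without atoms, so one may differentiate under the integral. -/
theorem differentiable_normPotential (μ : Measure E) [IsProbabilityMeasure μ] [NullSingletonClass μ] :
    Differentiable ℝ (normPotential μ) := by
  intro Q
  refine (hasFDerivAt_integral_of_dominated_loc_of_lip (𝕜 := ℝ) (s := Set.univ)
    (F := fun Q x => ‖x - Q‖ - ‖x‖) (bound := fun _ => (1 : ℝ))
    (F' := fun x => fderiv ℝ (fun y : E => ‖y‖) (Q - x)) univ_mem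
    (Eventually.of_forall fun Q => (integrable_norm_sub_sub_norm μ Q).aestronglyMeasurable)
    (integrable_norm_sub_sub_norm μ Q) ?_ ?_ (integrable_const _) ?_).2.differentiableAt
  · exact ((measurable_fderiv ℝ (fun y : E => ‖y‖)).comp
      (measurable_const.sub measurable_id)).aestronglyMeasurable
  · refine Eventually.of_forall fun x => (LipschitzWith.of_dist_le_mul fun a b => ?_).lipschitzOnWith
    have := abs_norm_sub_norm_le (x - a) (x - b)
    simpa [Real.dist_eq, dist_eq_norm, norm_sub_rev] using this
  · have hne : ∀ᵐ x ∂μ, x ≠ Q := by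
      simp [ae_iff]
    filter_upwards [hne] with x hx
    have hd : HasFDerivAt (fun y : E => ‖y‖) (fderiv ℝ (fun y : E => ‖y‖) (Q - x)) (Q - x) :=
      (differentiableAt_id.norm ℝ (sub_ne_zero.2 hx.symm)).hasFDerivAt
    have := (hd.comp Q ((hasFDerivAt_id Q).sub_const x)).sub_const ‖x‖
    simpa [Function.comp_def, norm_sub_rev] using this

/-- The gradient of the potential of a measure with full support has norm less than one. -/
theorem norm_lt_one_of_forall_normPotential_sub_inner_le (μ : Measure E) [IsProbabilityMeasure μ]
    [μ.IsOpenPosMeasure] {u q : E}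
    (hq : ∀ Q, normPotential μ q - inner ℝ u q ≤ normPotential μ Q - inner ℝ u Q) :
    ‖u‖ < 1 := by
  by_contra! hu
  -- If ‖u‖ ≥ 1, moving by u raises the potential by at least ‖u‖² ≥ ‖u‖, the largest rise allowed.
  -- Full support then forces equality at every x, which fails at x = q + u.
  have h := hq (q + u)
  rw [inner_add_right, real_inner_self_eq_norm_sq] at h
  have hnn : ∀ x : E, 0 ≤ ‖u‖ - (‖x - (q + u)‖ - ‖x - q‖) := by
    intro x
    have := norm_sub_norm_le (x - (q + u)) (x - q)
    have e : x - (q + u) - (x - q) = -u := by abel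
    rw [e, norm_neg] at this
    linarith
  have hi := integrable_norm_sub_sub_norm_sub μ (q + u) q
  have hintegrable := (integrable_const (μ := μ) ‖u‖).sub hi
  have hzero : ∫ x, (‖u‖ - (‖x - (q + u)‖ - ‖x - q‖)) ∂μ = 0 := by
    refine le_antisymm ?_ (integral_nonneg hnn)
    rw [integral_sub (integrable_const _) hi, ← normPotential_sub]
    simp only [integral_const, probReal_univ, smul_eq_mul, one_mul]
    nlinarith
  have hae := (integral_eq_zero_iff_of_nonneg hnn hintegrable).1 hzero
  have hfun := (Continuous.ae_eq_iff_eq μ (by fun_prop) (by fun_prop)).1 hae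
  have := congrFun hfun (q + u)
  simp only [sub_self, norm_zero, add_sub_cancel_left, Pi.zero_apply] at this
  linarith

end Potential

/-! ### The norm potential determines the measure -/

section Injectivity

open Module

variable {E : Type*} [NormedAddCommGroup E] [InnerProductSpace ℝ E]

/-- The kernel `(1 - cos ⟪y, ξ⟫) / ‖ξ‖ ^ (d + 1)`, whose integral over `ξ` is a multiple
of `‖y‖`. -/
noncomputable def cosKernel (y ξ : E) : ℝ :=
  (1 - Real.cos (inner ℝ y ξ)) / ‖ξ‖ ^ (finrank ℝ E + 1)

variable [MeasurableSpace E] [BorelSpace E]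

theorem measurable_cosKernel (y : E) : Measurable (cosKernel y) := by
  unfold cosKernel
  exact (measurable_const.sub (Real.measurable_cos.comp
    (continuous_const.inner continuous_id).measurable)).div (measurable_norm.pow_const _)

variable [FiniteDimensional ℝ E]

/-- In polar coordinates the radial integrand is min(1, r²)/r², bounded near 0 and at most r⁻² at
infinity. -/
theorem integrable_min_sq_div_norm_pow [Nontrivial E] :
    Integrable (fun ξ : E => min 1 (‖ξ‖ ^ 2) / ‖ξ‖ ^ (finrank ℝ E + 1)) := by
  rw [integrable_fun_norm_addHaar volume (f := fun r => min 1 (r ^ 2) / r ^ (finrank ℝ E + 1))]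
  have hD : finrank ℝ E + 1 = (finrank ℝ E - 1) + 2 := by
    have := finrank_pos (R := ℝ) (M := E)
    omega
  have heq : ∀ r ∈ Set.Ioi (0 : ℝ),
      min 1 (r ^ 2) / r ^ 2 = r ^ (finrank ℝ E - 1) • (min 1 (r ^ 2) / r ^ (finrank ℝ E + 1)) := by
    intro r hr
    have hr0 : r ≠ 0 := ne_of_gt hr
    rw [hD, smul_eq_mul, pow_add]
    field_simp
  refine IntegrableOn.congr_fun ?_ heq measurableSet_Ioi
  rw [← Set.Ioc_union_Ioi_eq_Ioi (zero_le_one (α := ℝ))]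
  refine IntegrableOn.union ?_ ?_
  · refine Measure.integrableOn_of_bounded (M := 1) (by simp)
      (Measurable.aestronglyMeasurable (by fun_prop)) ?_
    filter_upwards with r
    rw [Real.norm_of_nonneg (by positivity)]
    exact div_le_one_of_le₀ (min_le_right _ _) (by positivity)
  · refine Integrable.mono' (integrableOn_Ioi_rpow_of_lt (a := -2) (by norm_num) one_pos)
      (Measurable.aestronglyMeasurable (by fun_prop)) ?_
    filter_upwards [ae_restrict_mem measurableSet_Ioi] with r hr
    have hr0 : (0 : ℝ) < r := lt_trans one_pos hr
    rw [Real.norm_of_nonneg (by positivity), Real.rpow_neg hr0.le, Real.rpow_two, ← one_div]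
    gcongr
    exact min_le_left _ _

theorem integrable_cosKernel [Nontrivial E] (y : E) : Integrable (cosKernel y) := by
  refine Integrable.mono' (integrable_min_sq_div_norm_pow.const_mul (2 + ‖y‖ ^ 2))
    (measurable_cosKernel y).aestronglyMeasurable (Eventually.of_forall fun ξ => ?_)
  have h0 : 0 ≤ 1 - Real.cos (inner ℝ y ξ) := by linarith [Real.cos_le_one (inner ℝ y ξ)]
  have h2 : 1 - Real.cos (inner ℝ y ξ) ≤ 2 := by linarith [Real.neg_one_le_cos (inner ℝ y ξ)]
  have hsq : 1 - Real.cos (inner ℝ y ξ) ≤ ‖y‖ ^ 2 * ‖ξ‖ ^ 2 := by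
    have h := Real.one_sub_sq_div_two_le_cos (x := inner ℝ y ξ)
    have hc : (inner ℝ y ξ) ^ 2 ≤ (‖y‖ * ‖ξ‖) ^ 2 := sq_le_sq.2 <| by
      simpa [abs_mul] using abs_real_inner_le_norm y ξ
    rw [mul_pow] at hc
    nlinarith [sq_nonneg (inner ℝ y ξ)]
  unfold cosKernel
  rw [Real.norm_of_nonneg (by positivity), ← mul_div_assoc]
  gcongr
  rcases min_cases (1 : ℝ) (‖ξ‖ ^ 2) with ⟨h, _⟩ | ⟨h, _⟩ <;> rw [h]
  · nlinarith [sq_nonneg ‖y‖]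
  · nlinarith [sq_nonneg ‖ξ‖]

/-- The reflection exchanging y and z preserves both Lebesgue measure and the weight. -/
theorem integral_cosKernel_eq_of_norm_eq {y z : E} (h : ‖y‖ = ‖z‖) :
    ∫ ξ, cosKernel y ξ = ∫ ξ, cosKernel z ξ := by
  set T := (ℝ ∙ (y - z))ᗮ.reflection with hT
  have hyz : T y = z := Submodule.reflection_sub h
  have hmp : MeasurePreserving T.toHomeomorph.toMeasurableEquiv volume volume :=
    T.measurePreserving
  rw [← hmp.integral_comp' (cosKernel z)]
  congr 1 with ξ
  have : T.toHomeomorph.toMeasurableEquiv ξ = T ξ := rfl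
  rw [this, ← hyz]
  simp [cosKernel]

/-- Substituting tξ gives t^(d+1) from the weight and t^(-d) from the Jacobian. -/
theorem integral_cosKernel_smul (y : E) {t : ℝ} (ht : 0 < t) :
    ∫ ξ, cosKernel (t • y) ξ = t * ∫ ξ, cosKernel y ξ := by
  have h := Measure.integral_comp_smul volume (cosKernel y) t
  have e : ∀ ξ, cosKernel (t • y) ξ = t ^ (finrank ℝ E + 1) * cosKernel y (t • ξ) := by
    intro ξ
    unfold cosKernel
    rw [norm_smul, mul_pow, Real.norm_of_nonneg ht.le, inner_smul_left, inner_smul_right]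
    simp only [conj_trivial]
    rw [mul_div_assoc', mul_div_mul_left _ _ (by positivity)]
  simp_rw [e]
  rw [integral_const_mul, h, abs_of_pos (by positivity), smul_eq_mul, ← mul_assoc, pow_succ]
  field_simp

/-- The integral of the kernel is proportional to the norm. -/
theorem exists_integral_cosKernel_eq [Nontrivial E] :
    ∃ κ : ℝ, ∀ y : E, ∫ ξ, cosKernel y ξ = κ * ‖y‖ := by
  obtain ⟨e, he⟩ := exists_norm_eq E (zero_le_one (α := ℝ))
  refine ⟨∫ ξ, cosKernel e ξ, fun y => ?_⟩
  rcases eq_or_ne y 0 with rfl | hy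
  · simp [cosKernel]
  · have hy' : 0 < ‖y‖ := norm_pos_iff.2 hy
    rw [mul_comm, ← integral_cosKernel_smul e hy']
    exact integral_cosKernel_eq_of_norm_eq (by simp [norm_smul, he])

/-- The Fourier transform of the kernel is a second difference of the norm. -/
theorem integral_exp_mul_cosKernel [Nontrivial E] {κ : ℝ}
    (hκ : ∀ y : E, ∫ ξ, cosKernel y ξ = κ * ‖y‖) (Q y : E) :
    ∫ ξ, Complex.exp ((inner ℝ y ξ : ℝ) * Complex.I) * (cosKernel Q ξ : ℂ) =
      ((κ / 2 * (‖y + Q‖ + ‖y - Q‖ - 2 * ‖y‖) : ℝ) : ℂ) := by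
  have hcos : ∫ ξ, Real.cos (inner ℝ y ξ) * cosKernel Q ξ =
      κ / 2 * (‖y + Q‖ + ‖y - Q‖ - 2 * ‖y‖) := by
    -- This is cos(a + b) + cos(a - b) = 2 cos a cos b, which turns the product into a second
    -- difference in y.
    have e : ∀ ξ, Real.cos (inner ℝ y ξ) * cosKernel Q ξ =
        2⁻¹ * ((cosKernel (y + Q) ξ + cosKernel (y - Q) ξ) - 2 * cosKernel y ξ) := by
      intro ξ
      unfold cosKernel
      rw [inner_add_left, inner_sub_left, Real.cos_add, Real.cos_sub]
      ring
    simp_rw [e]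
    rw [integral_const_mul, integral_sub ((integrable_cosKernel _).fun_add (integrable_cosKernel _))
      ((integrable_cosKernel _).const_mul _), integral_add (integrable_cosKernel _)
      (integrable_cosKernel _), integral_const_mul, hκ, hκ, hκ]
    ring
  have hsin : ∫ ξ, Real.sin (inner ℝ y ξ) * cosKernel Q ξ = 0 := by
    have h := integral_neg_eq_self (fun ξ => Real.sin (inner ℝ y ξ) * cosKernel Q ξ) volume
    have e : ∀ ξ : E, Real.sin (inner ℝ y (-ξ)) * cosKernel Q (-ξ) =
        -(Real.sin (inner ℝ y ξ) * cosKernel Q ξ) := by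
      intro ξ
      simp [cosKernel]
    simp_rw [e] at h
    rw [integral_neg] at h
    linarith
  have hbd : ∀ g : ℝ → ℝ, Continuous g → (∀ t, |g t| ≤ 1) →
      Integrable fun ξ => g (inner ℝ y ξ) * cosKernel Q ξ := by
    intro g hg hg1
    refine (integrable_cosKernel Q).bdd_mul (c := 1) ?_ (Eventually.of_forall fun ξ => hg1 _)
    exact (hg.comp (continuous_const.inner continuous_id)).aestronglyMeasurable
  have hc : Integrable fun ξ => ((Real.cos (inner ℝ y ξ) * cosKernel Q ξ : ℝ) : ℂ) :=
    (hbd _ Real.continuous_cos Real.abs_cos_le_one).ofReal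
  have hs : Integrable fun ξ => ((Real.sin (inner ℝ y ξ) * cosKernel Q ξ : ℝ) : ℂ) :=
    (hbd _ Real.continuous_sin Real.abs_sin_le_one).ofReal
  have e : ∀ ξ, Complex.exp ((inner ℝ y ξ : ℝ) * Complex.I) * (cosKernel Q ξ : ℂ) =
      ((Real.cos (inner ℝ y ξ) * cosKernel Q ξ : ℝ) : ℂ) +
        ((Real.sin (inner ℝ y ξ) * cosKernel Q ξ : ℝ) : ℂ) * Complex.I := by
    intro ξ
    rw [Complex.exp_mul_I]
    push_cast
    ring
  simp_rw [e]
  rw [integral_add hc (hs.mul_const _), integral_mul_const, integral_complex_ofReal,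
    integral_complex_ofReal, hcos, hsin]
  simp

/-- Fubini: expanding the characteristic function averages the kernel's transform at x - a over x,
and the second differences of the norm become those of the potential. -/
theorem integral_exp_mul_charFun_mul_cosKernel [Nontrivial E] {κ : ℝ}
    (hκ : ∀ y : E, ∫ ξ, cosKernel y ξ = κ * ‖y‖) (μ : Measure E) [IsFiniteMeasure μ]
    (Q a : E) :
    ∫ ξ, Complex.exp ((-(inner ℝ ξ a) : ℝ) * Complex.I) * (charFun μ ξ * (cosKernel Q ξ : ℂ)) =
      ((κ / 2 * (normPotential μ (a - Q) + normPotential μ (a + Q) -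
        2 * normPotential μ a) : ℝ) : ℂ) := by
  have hintegrable : Integrable (Function.uncurry fun ξ x : E =>
      Complex.exp ((inner ℝ (x - a) ξ : ℝ) * Complex.I) * (cosKernel Q ξ : ℂ))
      (volume.prod μ) := by
    have h := ((integrable_cosKernel Q).comp_fst μ).ofReal (𝕜 := ℂ)
    refine h.bdd_mul (c := 1) ?_ (Eventually.of_forall fun z => ?_)
    · exact Continuous.aestronglyMeasurable (by fun_prop)
    · rw [Complex.norm_exp_ofReal_mul_I]
  have e : ∀ ξ, Complex.exp ((-(inner ℝ ξ a) : ℝ) * Complex.I) *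
      (charFun μ ξ * (cosKernel Q ξ : ℂ)) =
      ∫ x, Complex.exp ((inner ℝ (x - a) ξ : ℝ) * Complex.I) * (cosKernel Q ξ : ℂ) ∂μ := by
    intro ξ
    rw [integral_mul_const, charFun_apply, ← mul_assoc, ← integral_const_mul]
    congr 1
    refine integral_congr_ae (Eventually.of_forall fun x => ?_)
    simp only
    rw [← Complex.exp_add, inner_sub_left, real_inner_comm ξ a]
    congr 1
    push_cast
    ring
  simp_rw [e]
  rw [integral_integral_swap hintegrable]
  simp_rw [integral_exp_mul_cosKernel hκ]
  rw [integral_complex_ofReal, integral_const_mul]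
  congr 2
  have e1 : ∀ x, ‖x - a + Q‖ + ‖x - a - Q‖ - 2 * ‖x - a‖ =
      ((‖x - (a - Q)‖ - ‖x‖) + (‖x - (a + Q)‖ - ‖x‖)) - 2 * (‖x - a‖ - ‖x‖) := by
    intro x
    rw [show x - (a - Q) = x - a + Q by abel, show x - (a + Q) = x - a - Q by abel]
    ring
  simp_rw [e1]
  have hi := integrable_norm_sub_sub_norm μ
  rw [integral_sub ((hi _).fun_add (hi _)) ((hi _).const_mul _), integral_add (hi _) (hi _),
    integral_const_mul]
  rfl

/-- A probability measure is determined by its norm potential. -/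
theorem eq_of_normPotential_eq [Nontrivial E] (μ ν : Measure E) [IsProbabilityMeasure μ]
    [IsProbabilityMeasure ν] (h : normPotential μ = normPotential ν) : μ = ν := by
  obtain ⟨κ, hκ⟩ := exists_integral_cosKernel_eq (E := E)
  refine Measure.ext_of_charFun (funext fun ξ => ?_)
  rcases eq_or_ne ξ 0 with rfl | hξ
  · simp
  have hξ' : ‖ξ‖ ≠ 0 := norm_ne_zero_iff.2 hξ
  -- This makes ⟪Q, ξ⟫ = π, so the kernel equals 2/‖ξ‖^(d+1) at the given ξ and can be cancelled at
  -- the end.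
  set Q : E := (Real.pi / ‖ξ‖ ^ 2) • ξ with hQ
  have hker : cosKernel Q ξ ≠ 0 := by
    have : inner ℝ Q ξ = Real.pi := by
      rw [hQ, inner_smul_left, real_inner_self_eq_norm_sq]
      simp only [conj_trivial]
      field_simp
    rw [cosKernel, this, Real.cos_pi]
    positivity
  set f : E → ℂ := fun ξ => charFun μ ξ * (cosKernel Q ξ : ℂ) - charFun ν ξ * (cosKernel Q ξ : ℂ)
    with hf
  have hintegrable : ∀ ρ : Measure E, IsProbabilityMeasure ρ →
      Integrable fun ξ => charFun ρ ξ * (cosKernel Q ξ : ℂ) := by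
    intro ρ hρ
    refine ((integrable_cosKernel Q).ofReal (𝕜 := ℂ)).bdd_mul (c := 1)
      continuous_charFun.aestronglyMeasurable (Eventually.of_forall fun ξ => norm_charFun_le_one ξ)
  have hfint : Integrable f := (hintegrable μ ‹_›).sub (hintegrable ν ‹_›)
  have hfour : FourierTransform.fourier f = 0 := by
    funext w
    rw [Real.fourier_eq', Pi.zero_apply]
    have e : ∀ v, Complex.exp (((-2 * Real.pi * inner ℝ v w : ℝ) : ℂ) * Complex.I) • f v =
        Complex.exp ((-(inner ℝ v ((2 * Real.pi) • w)) : ℝ) * Complex.I) *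
            (charFun μ v * (cosKernel Q v : ℂ)) -
          Complex.exp ((-(inner ℝ v ((2 * Real.pi) • w)) : ℝ) * Complex.I) *
            (charFun ν v * (cosKernel Q v : ℂ)) := by
      intro v
      rw [hf, smul_eq_mul, mul_sub, inner_smul_right]
      simp only [neg_mul]
    simp_rw [e]
    have hb : ∀ ρ : Measure E, IsProbabilityMeasure ρ → Integrable fun v =>
        Complex.exp ((-(inner ℝ v ((2 * Real.pi) • w)) : ℝ) * Complex.I) *
          (charFun ρ v * (cosKernel Q v : ℂ)) := by
      intro ρ hρ
      refine (hintegrable ρ hρ).bdd_mul (c := 1) ?_ (Eventually.of_forall fun z => ?_)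
      · exact Continuous.aestronglyMeasurable (by fun_prop)
      · rw [Complex.norm_exp_ofReal_mul_I]
    rw [integral_sub (hb μ ‹_›) (hb ν ‹_›), integral_exp_mul_charFun_mul_cosKernel hκ,
      integral_exp_mul_charFun_mul_cosKernel hκ, h, sub_self]
  -- The kernel may be singular at 0, but inversion at the single point ξ needs continuity only
  -- there.
  have hcont : ContinuousAt f ξ := by
    have hk : ContinuousAt (cosKernel Q) ξ := by
      unfold cosKernel
      refine ContinuousAt.div (by fun_prop) (by fun_prop) (pow_ne_zero _ hξ')
    have hk' : ContinuousAt (fun ξ => (cosKernel Q ξ : ℂ)) ξ :=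
      Complex.continuous_ofReal.continuousAt.comp hk
    exact (continuous_charFun.continuousAt.mul hk').sub (continuous_charFun.continuousAt.mul hk')
  have hinv := hfint.fourierInv_fourier_eq (by rw [hfour]; exact integrable_zero _ _ _) hcont
  rw [hfour] at hinv
  have hz : f ξ = 0 := by
    rw [← hinv, Real.fourierInv_eq']
    simp
  rw [hf] at hz
  simp only [← sub_mul, mul_eq_zero, Complex.ofReal_eq_zero, hker, or_false] at hz
  exact sub_eq_zero.1 hz

end Injectivity

/-! ### Stability of minimizers and of subgradients -/

section Stability

theorem IsCompact.eventually_forall_of_forall_eventually_prod {ι Y : Type*} [TopologicalSpace Y]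
    {K : Set Y} (hK : IsCompact K) {l : Filter ι} {p : ι → Y → Prop}
    (h : ∀ y ∈ K, ∀ᶠ z in l ×ˢ 𝓝 y, p z.1 z.2) : ∀ᶠ i in l, ∀ y ∈ K, p i y := by
  have h' : ∀ᶠ z in l ×ˢ 𝓝ˢ K, p z.1 z.2 :=
    hK.mem_prod_nhdsSet_of_forall (s := {z | p z.1 z.2}) h
  exact h'.curry.mono fun i hi y hy => hi.self_of_nhdsSet y hy

/-- Convex functions uniformly close to a function with a strict minimum attain their minima, all
of them near that strict minimum. -/
theorem ConvexOn.exists_forall_minimizer_near {E : Type*} [NormedAddCommGroup E]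
    [NormedSpace ℝ E] [ProperSpace E] {f : E → ℝ} (hf : Continuous f) {q₀ : E}
    (hq₀ : ∀ p, p ≠ q₀ → f q₀ < f p) {ε : ℝ} (hε : 0 < ε) :
    ∃ δ > 0, ∀ g : E → ℝ, ConvexOn ℝ Set.univ g → Continuous g →
      (∀ Q ∈ Metric.closedBall q₀ ε, |g Q - f Q| < δ) →
      (∃ q, ∀ Q, g q ≤ g Q) ∧ ∀ q, (∀ Q, g q ≤ g Q) → ‖q - q₀‖ < ε := by
  -- With δ half the gap between f q₀ and the bound a on the sphere, g is still larger on the sphere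
  -- than at q₀.
  obtain ⟨a, ha, hfa⟩ := (isCompact_sphere q₀ ε).exists_forall_le' hf.continuousOn (a := f q₀)
    (fun p hp => hq₀ p (Metric.ne_of_mem_sphere hp hε.ne'))
  refine ⟨(a - f q₀) / 2, by linarith, fun g hg hgc hclose => ?_⟩
  have hcen := (abs_lt.1 (hclose q₀ (Metric.mem_closedBall_self hε.le))).2
  have hsph : ∀ p ∈ Metric.sphere q₀ ε, g q₀ < g p := by
    intro p hp
    have h1 := (abs_lt.1 (hclose p (Metric.sphere_subset_closedBall hp))).1
    have h2 := hfa p hp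
    linarith
  -- The segment from q₀ to p crosses the sphere; convexity carries the strict inequality outwards
  -- to p.
  have hout : ∀ p, ε ≤ ‖p - q₀‖ → g q₀ < g p := by
    intro p hp
    have hp0 : 0 < ‖p - q₀‖ := hε.trans_le hp
    set t := ε / ‖p - q₀‖ with ht
    have ht0 : 0 < t := div_pos hε hp0
    have ht1 : t ≤ 1 := (div_le_one hp0).2 hp
    have hmem : (1 - t) • q₀ + t • p ∈ Metric.sphere q₀ ε := by
      have e : (1 - t) • q₀ + t • p - q₀ = t • (p - q₀) := by module
      rw [mem_sphere_iff_norm, e, norm_smul, Real.norm_of_nonneg ht0.le, ht,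
        div_mul_cancel₀ _ hp0.ne']
    have h1 := hsph _ hmem
    have h2 := hg.2 (Set.mem_univ q₀) (Set.mem_univ p) (sub_nonneg.2 ht1) ht0.le (by ring)
    simp only [smul_eq_mul] at h2
    by_contra! hle
    nlinarith
  constructor
  · obtain ⟨q, hq, hmin⟩ := (isCompact_closedBall q₀ ε).exists_isMinOn
      ⟨q₀, Metric.mem_closedBall_self hε.le⟩ hgc.continuousOn
    refine ⟨q, fun Q => ?_⟩
    by_cases hQ : ‖Q - q₀‖ ≤ ε
    · exact hmin (mem_closedBall_iff_norm.2 hQ)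
    · exact (hmin (Metric.mem_closedBall_self hε.le)).trans (hout Q (not_le.1 hQ).le).le
  · intro q hq
    by_contra! hle
    exact absurd (hq q₀) (not_le.2 (hout q hle))

variable {E : Type*} [NormedAddCommGroup E] [InnerProductSpace ℝ E] [MeasurableSpace E]

/-- `q` minimizes the potential of `μ` tilted by the linear functional `u`. -/
abbrev IsTiltedMinimizer (μ : Measure E) (u q : E) : Prop :=
  ∀ Q, normPotential μ q - inner ℝ u q ≤ normPotential μ Q - inner ℝ u Q

/-- At a minimizer the tilt is the gradient of the potential. -/
theorem IsTiltedMinimizer.hasFDerivAt {ν : Measure E} {u₀ q₀ : E}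
    (hd : DifferentiableAt ℝ (normPotential ν) q₀) (hq₀ : IsTiltedMinimizer ν u₀ q₀) :
    HasFDerivAt (normPotential ν) (innerSL ℝ u₀) q₀ := by
  have h1 : HasFDerivAt (fun Q => normPotential ν Q - inner ℝ u₀ Q)
      (fderiv ℝ (normPotential ν) q₀ - innerSL ℝ u₀) q₀ :=
    hd.hasFDerivAt.sub (innerSL ℝ u₀).hasFDerivAt
  have h2 : IsLocalMin (fun Q => normPotential ν Q - inner ℝ u₀ Q) q₀ := Eventually.of_forall hq₀
  have h3 := h2.hasFDerivAt_eq_zero h1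
  rw [← sub_eq_zero.1 h3]
  exact hd.hasFDerivAt

variable [FiniteDimensional ℝ E] [BorelSpace E]

theorem IsTiltedMinimizer.norm_le_one {μ : Measure E} [IsProbabilityMeasure μ] {u q : E}
    (h : IsTiltedMinimizer μ u q) : ‖u‖ ≤ 1 := by
  have h1 := h (q + u)
  have h2 := normPotential_sub_le μ (q + u) q
  rw [inner_add_right, real_inner_self_eq_norm_sq] at h1
  rw [add_sub_cancel_left] at h2
  by_contra! hu
  nlinarith

variable {ι : Type*} {l : Filter ι} {μ : ι → Measure E} {ν : Measure E} [IsProbabilityMeasure ν]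

/-- Pointwise convergence of potentials is locally uniform. -/
theorem eventually_abs_normPotential_sub_lt (hμ : ∀ᶠ i in l, IsProbabilityMeasure (μ i))
    (hlim : ∀ Q, Tendsto (fun i => normPotential (μ i) Q) l (𝓝 (normPotential ν Q)))
    {K : Set E} (hK : IsCompact K) {δ : ℝ} (hδ : 0 < δ) :
    ∀ᶠ i in l, ∀ Q ∈ K, |normPotential (μ i) Q - normPotential ν Q| < δ := by
  refine hK.eventually_forall_of_forall_eventually_prod fun Q _ => ?_
  have h1 : ∀ᶠ i in l, |normPotential (μ i) Q - normPotential ν Q| < δ / 3 := by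
    simpa [Real.dist_eq] using (hlim Q).eventually (Metric.ball_mem_nhds _ (by positivity))
  have h2 : ∀ᶠ Q' in 𝓝 Q, ‖Q' - Q‖ < δ / 3 := eventually_norm_sub_lt Q (by positivity)
  filter_upwards [(hμ.and h1).prod_mk h2] with z hz
  obtain ⟨⟨hp, hz1⟩, hz2⟩ := hz
  have a1 := abs_lt.1 hz1
  have a2 := abs_le.1 (abs_normPotential_sub_le (μ z.1) z.2 Q)
  have a3 := abs_le.1 (abs_normPotential_sub_le ν z.2 Q)
  rw [abs_lt]
  constructor <;> linarith

/-- Tilted minimizers depend continuously on the measure and the tilt. -/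
theorem eventually_tiltedMinimizer_near (hμ : ∀ᶠ i in l, IsProbabilityMeasure (μ i))
    (hlim : ∀ Q, Tendsto (fun i => normPotential (μ i) Q) l (𝓝 (normPotential ν Q)))
    {u₀ q₀ : E}
    (hq₀ : ∀ p, p ≠ q₀ →
      normPotential ν q₀ - inner ℝ u₀ q₀ < normPotential ν p - inner ℝ u₀ p)
    {ε : ℝ} (hε : 0 < ε) :
    ∀ᶠ z in l ×ˢ 𝓝 u₀, (∃ q, IsTiltedMinimizer (μ z.1) z.2 q) ∧
      ∀ q, IsTiltedMinimizer (μ z.1) z.2 q → ‖q - q₀‖ < ε := by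
  have hν := continuous_normPotential ν
  obtain ⟨δ, hδ, hstab⟩ := ConvexOn.exists_forall_minimizer_near
    (f := fun Q => normPotential ν Q - inner ℝ u₀ Q) (by fun_prop) hq₀ hε
  have h1 := hμ.and (eventually_abs_normPotential_sub_lt hμ hlim (isCompact_closedBall q₀ ε)
    (half_pos hδ))
  have hR : 0 < ‖q₀‖ + ε := by positivity
  have h2 : ∀ᶠ u in 𝓝 u₀, ‖u - u₀‖ < δ / 2 / (‖q₀‖ + ε) :=
    eventually_norm_sub_lt u₀ (by positivity)
  filter_upwards [h1.prod_mk h2] with z hz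
  obtain ⟨⟨hp, hz1⟩, hz2⟩ := hz
  have hc := continuous_normPotential (μ z.1)
  refine hstab (fun Q => normPotential (μ z.1) Q - inner ℝ z.2 Q) ?_ (by fun_prop) ?_
  · exact (convexOn_normPotential (μ z.1)).sub ((innerSL ℝ z.2).toLinearMap.concaveOn convex_univ)
  · intro Q hQ
    have hQn : ‖Q‖ ≤ ‖q₀‖ + ε := by
      have := norm_le_norm_add_norm_sub' Q q₀
      linarith [mem_closedBall_iff_norm.1 hQ]
    have e : normPotential (μ z.1) Q - inner ℝ z.2 Q - (normPotential ν Q - inner ℝ u₀ Q) =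
        (normPotential (μ z.1) Q - normPotential ν Q) - inner ℝ (z.2 - u₀) Q := by
      rw [inner_sub_left]; ring
    have b1 := hz1 Q hQ
    have b2 : |inner ℝ (z.2 - u₀) Q| < δ / 2 := by
      refine (abs_real_inner_le_norm _ _).trans_lt ?_
      calc ‖z.2 - u₀‖ * ‖Q‖ ≤ ‖z.2 - u₀‖ * (‖q₀‖ + ε) := by gcongr
        _ < δ / 2 := (lt_div_iff₀ hR).1 hz2
    rw [e]
    calc _ ≤ _ := abs_sub _ _
      _ < δ := by linarith

/-- Subgradients of nearby potentials at nearby points are close to the gradient. -/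
theorem exists_eventually_tilt_near (hμ : ∀ᶠ i in l, IsProbabilityMeasure (μ i))
    (hlim : ∀ Q, Tendsto (fun i => normPotential (μ i) Q) l (𝓝 (normPotential ν Q)))
    {u₀ q₀ : E} (hd : DifferentiableAt ℝ (normPotential ν) q₀) (hq₀ : IsTiltedMinimizer ν u₀ q₀)
    {η : ℝ} (hη : 0 < η) :
    ∃ ρ > 0, ∀ᶠ i in l, ∀ q u, ‖q - q₀‖ < ρ → IsTiltedMinimizer (μ i) u q → ‖u - u₀‖ < η := by
  have hder := (hq₀.hasFDerivAt hd).isLittleO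
  have hder' := hder.def (show 0 < η / 4 by positivity)
  obtain ⟨s, hs, hball⟩ := Metric.eventually_nhds_iff.1 hder'
  set t := s / 2 with ht
  have ht0 : 0 < t := half_pos hs
  -- Step from q₀ by w, of length t in the direction u - u₀, so that ⟪u - u₀, w⟫ = t‖u - u₀‖. This
  -- is at most tη/4 from differentiability plus four errors of tη/16: two from replacing the
  -- potential, two from replacing q by q₀.
  refine ⟨t * η / 16, by positivity, ?_⟩
  filter_upwards [hμ, eventually_abs_normPotential_sub_lt hμ hlim (isCompact_closedBall q₀ t)
    (show 0 < t * η / 16 by positivity)] with i hp hclose q u hq hmin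
  rcases eq_or_ne u u₀ with rfl | hne
  · simpa using hη
  have hn : 0 < ‖u - u₀‖ := norm_pos_iff.2 (sub_ne_zero.2 hne)
  set w : E := (t / ‖u - u₀‖) • (u - u₀) with hw
  have hwn : ‖w‖ = t := by
    rw [hw, norm_smul, Real.norm_of_nonneg (by positivity), div_mul_cancel₀ _ hn.ne']
  have hinner : inner ℝ u w - inner ℝ u₀ w = t * ‖u - u₀‖ := by
    rw [← inner_sub_left, hw, inner_smul_right, real_inner_self_eq_norm_sq]
    field_simp
  have c1 := abs_lt.1 (hclose q₀ (Metric.mem_closedBall_self ht0.le))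
  have c2 := abs_lt.1 (hclose (q₀ + w) (by simp [hwn]))
  have c3 := hball (y := q₀ + w) (by simp [hwn, ht, hs])
  simp only [add_sub_cancel_left, Real.norm_eq_abs, hwn] at c3
  have c4 := (abs_le.1 c3).2
  simp only [innerSL_apply_apply] at c4
  have c5 := abs_le.1 (abs_normPotential_sub_le (μ i) q q₀)
  have c6 := hmin (q₀ + w)
  have c7 : inner ℝ u (q - q₀) ≤ ‖q - q₀‖ := by
    refine (real_inner_le_norm _ _).trans ?_
    nlinarith [hmin.norm_le_one, norm_nonneg (q - q₀)]
  rw [inner_sub_right] at c7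
  rw [inner_add_right] at c6
  have : t * ‖u - u₀‖ ≤ t * (η / 2) := by linarith
  have := le_of_mul_le_mul_left this ht0
  linarith

end Stability

/-! ### Empirical distributions -/

section Empirical

variable {d : ℕ}

theorem quantileObjective_eq (μ : Measure (EuclideanSpace ℝ (Fin d))) [IsProbabilityMeasure μ]
    (u Q : EuclideanSpace ℝ (Fin d)) :
    quantileObjective μ u Q = normPotential μ Q - inner ℝ u Q := by
  have e : ∀ x, quantileLoss u (x - Q) - quantileLoss u x = (‖x - Q‖ - ‖x‖) - inner ℝ u Q := by
    intro x
    rw [quantileLoss, quantileLoss, inner_sub_right]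
    ring
  unfold quantileObjective
  simp_rw [e]
  rw [integral_sub (integrable_norm_sub_sub_norm μ Q) (integrable_const _)]
  simp [normPotential]

theorem isSpatialQuantile_iff (μ : Measure (EuclideanSpace ℝ (Fin d))) [IsProbabilityMeasure μ]
    (u q : EuclideanSpace ℝ (Fin d)) :
    IsSpatialQuantile μ u q ↔ IsTiltedMinimizer μ u q := by
  simp only [IsSpatialQuantile, quantileObjective_eq, IsTiltedMinimizer]

theorem isTiltedMinimizer_spatialQuantile {μ : Measure (EuclideanSpace ℝ (Fin d))}
    [IsProbabilityMeasure μ] {u : EuclideanSpace ℝ (Fin d)} (h : ∃ q, IsTiltedMinimizer μ u q) :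
    IsTiltedMinimizer μ u (spatialQuantile μ u) := by
  simp only [← isSpatialQuantile_iff] at h ⊢
  exact Classical.epsilon_spec h

theorem isProbabilityMeasure_empiricalDistribution {n : ℕ} (hn : n ≠ 0)
    (x : Fin n → EuclideanSpace ℝ (Fin d)) : IsProbabilityMeasure (empiricalDistribution x) := by
  constructor
  simp only [empiricalDistribution, Measure.smul_apply, Measure.coe_finsetSum, Finset.sum_apply,
    measure_univ, Finset.sum_const, Finset.card_univ, Fintype.card_fin, smul_eq_mul, nsmul_eq_mul,
    mul_one]
  exact ENNReal.inv_mul_cancel (by exact_mod_cast hn) (ENNReal.natCast_ne_top n)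

theorem normPotential_empiricalDistribution {n : ℕ} (x : Fin n → EuclideanSpace ℝ (Fin d))
    (Q : EuclideanSpace ℝ (Fin d)) :
    normPotential (empiricalDistribution x) Q = (∑ i, (‖x i - Q‖ - ‖x i‖)) / n := by
  rw [normPotential, empiricalDistribution, integral_smul_measure,
    integral_finsetSum_measure fun i _ => integrable_norm_sub_sub_norm _ Q]
  simp only [integral_dirac, ENNReal.toReal_inv, ENNReal.toReal_natCast, smul_eq_mul]
  rw [div_eq_inv_mul]

/-- A point minimizes the empirical potential tilted by its own spatial rank. -/
theorem isTiltedMinimizer_spatialRank {n : ℕ} (x : Fin n → EuclideanSpace ℝ (Fin d))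
    (z : EuclideanSpace ℝ (Fin d)) :
    IsTiltedMinimizer (empiricalDistribution x) (spatialRank x z) z := by
  classical
  intro Q
  -- This is the subgradient inequality for each ‖x i - ·‖; for data equal to z, the omitted rank
  -- terms correspond to the subgradient 0 of the norm at the origin.
  have hterm : ∀ i, (if x i ≠ z then inner ℝ (‖z - x i‖⁻¹ • (z - x i)) (Q - z) else 0) ≤
      (‖x i - Q‖ - ‖x i‖) - (‖x i - z‖ - ‖x i‖) := by
    intro i
    split_ifs with h
    · have hn : 0 < ‖z - x i‖ := norm_pos_iff.2 (sub_ne_zero.2 (Ne.symm h))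
      have h1 : inner ℝ (‖z - x i‖⁻¹ • (z - x i)) (Q - x i) ≤ ‖Q - x i‖ := by
        refine (real_inner_le_norm _ _).trans_eq ?_
        rw [norm_smul, norm_inv, norm_norm, inv_mul_cancel₀ hn.ne', one_mul]
      have h2 : inner ℝ (‖z - x i‖⁻¹ • (z - x i)) (z - x i) = ‖z - x i‖ := by
        rw [inner_smul_left, real_inner_self_eq_norm_sq]
        simp only [conj_trivial]
        field_simp
      have e : Q - x i = (Q - z) + (z - x i) := by abel
      rw [e, inner_add_right, h2, ← e] at h1
      rw [norm_sub_rev (x i) Q, norm_sub_rev (x i) z]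
      linarith
    · push Not at h
      simp [h]
  have hsum := Finset.sum_le_sum fun i (_ : i ∈ Finset.univ) => hterm i
  rw [Finset.sum_sub_distrib, ← Finset.sum_filter] at hsum
  have hinner : inner ℝ (spatialRank x z) (Q - z) =
      (∑ i with x i ≠ z, inner ℝ (‖z - x i‖⁻¹ • (z - x i)) (Q - z)) / n := by
    rw [spatialRank, inner_smul_left, sum_inner, div_eq_inv_mul]
    simp only [conj_trivial]
  have hle := div_le_div_of_nonneg_right hsum (Nat.cast_nonneg (α := ℝ) n)
  rw [← hinner, sub_div, ← normPotential_empiricalDistribution,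
    ← normPotential_empiricalDistribution, inner_sub_right] at hle
  linarith

/-- The filter of events `S ⊆ ℕ × Ω` whose `N`-th section has probability tending to one. -/
def inProbability {Ω : Type*} [MeasurableSpace Ω] (P : Measure Ω) : Filter (ℕ × Ω) where
  sets := {S | Tendsto (fun N => P {ω | (N, ω) ∉ S}) atTop (𝓝 0)}
  univ_sets := by simp
  sets_of_superset {S T} hS hST := tendsto_of_tendsto_of_tendsto_of_le_of_le tendsto_const_nhds hS
    (fun _ => zero_le) fun _ => measure_mono fun _ h h' => h (hST h')
  inter_sets {S T} hS hT := by
    have h : Tendsto (fun N => P {ω | (N, ω) ∉ S} + P {ω | (N, ω) ∉ T}) atTop (𝓝 0) := by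
      simpa using Tendsto.add hS hT
    refine tendsto_of_tendsto_of_tendsto_of_le_of_le tendsto_const_nhds h
      (fun _ => zero_le) fun N => (measure_mono fun ω hω => ?_).trans (measure_union_le _ _)
    by_contra hc
    simp only [Set.mem_union, Set.mem_ofPred_eq, not_or, not_not] at hc
    exact hω hc

theorem eventually_inProbability_iff {Ω : Type*} [MeasurableSpace Ω] {P : Measure Ω}
    {p : ℕ × Ω → Prop} :
    (∀ᶠ z in inProbability P, p z) ↔ Tendsto (fun N => P {ω | ¬ p (N, ω)}) atTop (𝓝 0) :=
  Iff.rfl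

theorem eventually_inProbability_of_eventually {Ω : Type*} [MeasurableSpace Ω] {P : Measure Ω}
    {p : ℕ → Prop} (h : ∀ᶠ N in atTop, p N) : ∀ᶠ z in inProbability P, p z.1 := by
  rw [eventually_inProbability_iff]
  refine tendsto_const_nhds.congr' ?_
  filter_upwards [h] with N hN
  simp [hN]

theorem tendsto_measure_one_of_eventually_inProbability {Ω : Type*} [MeasurableSpace Ω]
    {P : Measure Ω} [IsProbabilityMeasure P] {p : ℕ × Ω → Prop}
    (h : ∀ᶠ z in inProbability P, p z) :
    Tendsto (fun N => P {ω | p (N, ω)}) atTop (𝓝 1) := by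
  rw [eventually_inProbability_iff] at h
  have h' : Tendsto (fun N => 1 - P {ω | ¬ p (N, ω)}) atTop (𝓝 1) := by
    simpa using ENNReal.Tendsto.sub tendsto_const_nhds h (Or.inl ENNReal.one_ne_top)
  refine tendsto_of_tendsto_of_tendsto_of_le_of_le h' tendsto_const_nhds (fun N => ?_)
    fun N => prob_le_one
  -- Subadditivity is used in place of the complement rule, since the event is not assumed
  -- measurable.
  rw [tsub_le_iff_right, ← measure_univ (μ := P)]
  refine (measure_mono fun ω _ => ?_).trans (measure_union_le _ _)
  exact em (p (N, ω))

/-- The weak law of large numbers for bounded functions of the observations. -/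
theorem tendsto_average_inProbability {Ω : Type*} [MeasurableSpace Ω] {P : Measure Ω}
    [IsProbabilityMeasure P] {F : Measure (EuclideanSpace ℝ (Fin d))}
    {X : ℕ → Ω → EuclideanSpace ℝ (Fin d)} (hX : ∀ j, HasLaw (X j) F P)
    (hind : Pairwise fun i j => IndepFun (X i) (X j) P)
    {n : ℕ → ℕ} (hn : Tendsto n atTop atTop)
    {h : EuclideanSpace ℝ (Fin d) → ℝ} (hm : Measurable h) {C : ℝ} (hC : ∀ x, |h x| ≤ C) :
    Tendsto (fun z : ℕ × Ω => (∑ j : Fin (n z.1), h (X j z.2)) / (n z.1 : ℝ)) (inProbability P)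
      (𝓝 (∫ x, h x ∂F)) := by
  have hmeas : ∀ j, AEStronglyMeasurable (fun ω => h (X j ω)) P := fun j =>
    (hm.comp_aemeasurable (hX j).aemeasurable).aestronglyMeasurable
  have hslln := strong_law_ae_real (μ := P) (fun j ω => h (X j ω))
    (Integrable.of_bound (hmeas 0) C (Eventually.of_forall fun ω => hC _))
    (fun i j hij => (hind hij).comp hm hm)
    (fun j => ((hX j).identDistrib (hX 0)).comp hm)
  have hintegrable : ∫ ω, h (X 0 ω) ∂P = ∫ x, h x ∂F := (hX 0).integral_comp hm.aestronglyMeasurable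
  rw [hintegrable] at hslln
  have hmeas' : ∀ k : ℕ, AEStronglyMeasurable
      (fun ω => (∑ j ∈ Finset.range k, h (X j ω)) / (k : ℝ)) P := by
    intro k
    simp only [div_eq_mul_inv]
    exact (Finset.aestronglyMeasurable_fun_sum _ fun j _ => hmeas j).mul_const _
  -- Passing to convergence in measure along k = 1, 2, … first allows composition with any sample
  -- sizes tending to infinity.
  have hprob := (tendstoInMeasure_iff_dist.1 (tendstoInMeasure_of_tendsto_ae hmeas' hslln))
  rw [Metric.tendsto_nhds]
  intro ε hε
  rw [eventually_inProbability_iff]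
  refine ((hprob ε hε).comp hn).congr fun N => ?_
  simp only [Function.comp_apply, not_lt, Finset.sum_range]

end Empirical

/-! ### The Q-Q plots -/

section QQPlot

variable {d : ℕ}

theorem HasPositiveLocallyBoundedDensity.isOpenPosMeasure
    {F : Measure (EuclideanSpace ℝ (Fin d))} (hF : HasPositiveLocallyBoundedDensity F) :
    F.IsOpenPosMeasure := by
  obtain ⟨f, hm, hpos, -, rfl⟩ := hF
  refine (withDensity_absolutelyContinuous' hm.ennreal_ofReal.aemeasurable
    (Eventually.of_forall fun x => ?_)).isOpenPosMeasure
  simpa using hpos x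

theorem HasPositiveLocallyBoundedDensity.nullSingletonClass (hd : 2 ≤ d)
    {F : Measure (EuclideanSpace ℝ (Fin d))} (hF : HasPositiveLocallyBoundedDensity F) :
    NullSingletonClass F := by
  obtain ⟨f, -, -, -, rfl⟩ := hF
  have : NeZero d := ⟨by omega⟩
  exact ⟨fun x => withDensity_absolutelyContinuous _ _ (measure_singleton x)⟩

/-! ### Convergence of empirical potentials and quantiles in probability -/

section Sample

variable {Ω : Type*} [MeasurableSpace Ω] {P : Measure Ω} [IsProbabilityMeasure P]
  {F : Measure (EuclideanSpace ℝ (Fin d))} {X : ℕ → Ω → EuclideanSpace ℝ (Fin d)}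
  {n : ℕ → ℕ}

theorem eventually_isProbabilityMeasure_empiricalDistribution (P : Measure Ω)
    (X : ℕ → Ω → EuclideanSpace ℝ (Fin d)) (hn : Tendsto n atTop atTop) :
    ∀ᶠ z in inProbability P,
      IsProbabilityMeasure (empiricalDistribution fun j : Fin (n z.1) => X j z.2) := by
  have h := eventually_inProbability_of_eventually (P := P) (hn.eventually_gt_atTop 0)
  filter_upwards [h] with z hz
  exact isProbabilityMeasure_empiricalDistribution hz.ne' _

theorem tendsto_normPotential_empiricalDistribution (hX : ∀ j, HasLaw (X j) F P)
    (hind : Pairwise fun i j => IndepFun (X i) (X j) P) (hn : Tendsto n atTop atTop)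
    (Q : EuclideanSpace ℝ (Fin d)) :
    Tendsto (fun z : ℕ × Ω =>
        normPotential (empiricalDistribution fun j : Fin (n z.1) => X j z.2) Q)
      (inProbability P) (𝓝 (normPotential F Q)) := by
  simp_rw [normPotential_empiricalDistribution]
  exact tendsto_average_inProbability hX hind hn (h := fun x => ‖x - Q‖ - ‖x‖)
    (Continuous.measurable (by fun_prop)) (fun x => abs_norm_sub_sub_norm_le x Q)

/-- The fraction of observations in the ball tends to its probability, positive by full support. -/
theorem eventually_exists_sample_near [IsProbabilityMeasure F] [F.IsOpenPosMeasure]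
    (hX : ∀ j, HasLaw (X j) F P)
    (hind : Pairwise fun i j => IndepFun (X i) (X j) P) (hn : Tendsto n atTop atTop)
    (q : EuclideanSpace ℝ (Fin d)) {ρ : ℝ} (hρ : 0 < ρ) :
    ∀ᶠ z in inProbability P, ∃ k : Fin (n z.1), ‖X k z.2 - q‖ < ρ := by
  set h := (Metric.ball q ρ).indicator (1 : EuclideanSpace ℝ (Fin d) → ℝ) with hh
  have hlim := tendsto_average_inProbability hX hind hn (h := h) (C := 1)
    (measurable_one.indicator Metric.isOpen_ball.measurableSet)
    (fun x => by by_cases hx : x ∈ Metric.ball q ρ <;> simp [hh, hx])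
  rw [hh, integral_indicator_one Metric.isOpen_ball.measurableSet, ← hh] at hlim
  have hpos : 0 < F.real (Metric.ball q ρ) :=
    ENNReal.toReal_pos (Metric.measure_ball_pos F q hρ).ne' (measure_ne_top _ _)
  filter_upwards [hlim.eventually (lt_mem_nhds hpos)] with z hz
  by_contra! hc
  refine hz.ne' ?_
  rw [Finset.sum_eq_zero, zero_div]
  intro k _
  exact Set.indicator_of_notMem (by simpa [dist_eq_norm] using hc k) _

/-- Consistency of the empirical spatial quantiles, uniformly near a given level. -/
theorem eventually_empiricalSpatialQuantile_near [IsProbabilityMeasure F]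
    (hX : ∀ j, HasLaw (X j) F P)
    (hind : Pairwise fun i j => IndepFun (X i) (X j) P) (hn : Tendsto n atTop atTop)
    {u₀ q₀ : EuclideanSpace ℝ (Fin d)}
    (hq₀ : ∀ p, p ≠ q₀ →
      normPotential F q₀ - inner ℝ u₀ q₀ < normPotential F p - inner ℝ u₀ p)
    {ε : ℝ} (hε : 0 < ε) :
    ∀ᶠ z in inProbability P ×ˢ 𝓝 u₀,
      ‖empiricalSpatialQuantile (fun j : Fin (n z.1.1) => X j z.1.2) z.2 - q₀‖ < ε := by
  have hp := eventually_isProbabilityMeasure_empiricalDistribution P X hn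
  filter_upwards [hp.prod_inl (𝓝 u₀), eventually_tiltedMinimizer_near hp
    (tendsto_normPotential_empiricalDistribution hX hind hn) hq₀ hε] with z hz1 hz2
  exact hz2.2 _ (isTiltedMinimizer_spatialQuantile hz2.1)

end Sample

theorem mem_lineNeighborhood_of_abs_sub_lt {a b ε : ℝ} (h : |b - a| < ε) :
    !₂[a, b] ∈ lineNeighborhood ε := by
  refine Metric.mem_thickening_iff.2 ⟨!₂[a, a], by simp, ?_⟩
  rw [EuclideanSpace.dist_eq]
  simpa [Real.sqrt_sq_eq_abs, Real.dist_eq] using h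

theorem abs_sub_lt_of_mem_lineNeighborhood {a b ε : ℝ} (h : !₂[a, b] ∈ lineNeighborhood ε) :
    |b - a| < 2 * ε := by
  obtain ⟨p, hp, hdist⟩ := Metric.mem_thickening_iff.1 h
  have hp' : p 1 = p 0 := hp
  rw [dist_eq_norm] at hdist
  have h0 := abs_le.1 ((PiLp.norm_apply_le (!₂[a, b] - p) 0))
  have h1 := abs_le.1 ((PiLp.norm_apply_le (!₂[a, b] - p) 1))
  simp at h0 h1
  rw [abs_lt]
  constructor <;> linarith

/-- If two measures with full support and smooth potentials differ, some spatial quantile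
distinguishes them. -/
theorem exists_tiltedMinimizer_ne {E : Type*} [NormedAddCommGroup E] [InnerProductSpace ℝ E]
    [FiniteDimensional ℝ E] [MeasurableSpace E] [BorelSpace E] [Nontrivial E]
    (μ ν : Measure E) [IsProbabilityMeasure μ] [IsProbabilityMeasure ν]
    [μ.IsOpenPosMeasure] [NullSingletonClass μ] [NullSingletonClass ν] (hne : μ ≠ ν) :
    ∃ u p q, ‖u‖ < 1 ∧ IsTiltedMinimizer μ u p ∧ IsTiltedMinimizer ν u q ∧ p ≠ q := by
  have hdμ := differentiable_normPotential μ
  have hdν := differentiable_normPotential ν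
  -- Both potentials vanish at 0, so equal gradients everywhere would make them, and hence the
  -- measures, equal.
  obtain ⟨p, hp⟩ : ∃ p, fderiv ℝ (normPotential μ) p ≠ fderiv ℝ (normPotential ν) p := by
    by_contra! hall
    refine hne (eq_of_normPotential_eq μ ν (funext fun Q => ?_))
    have hder : ∀ Q, fderiv ℝ (fun x => normPotential μ x - normPotential ν x) Q = 0 := by
      intro Q
      rw [fderiv_fun_sub (hdμ Q) (hdν Q), hall, sub_self]
    have := is_const_of_fderiv_eq_zero (hdμ.sub hdν) hder Q 0
    simp only [Pi.sub_apply, normPotential_zero, sub_zero] at this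
    exact sub_eq_zero.1 this
  set u := (InnerProductSpace.toDual ℝ E).symm (fderiv ℝ (normPotential μ) p) with hu
  have hinner : ∀ v, inner ℝ u v = fderiv ℝ (normPotential μ) p v := fun v => by
    rw [hu, InnerProductSpace.toDual_symm_apply]
  have hpmin : IsTiltedMinimizer μ u p := by
    intro Q
    have h := (convexOn_normPotential μ).add_fderiv_le (hdμ p) Q
    rw [← hinner, inner_sub_right] at h
    linarith
  have hu1 := norm_lt_one_of_forall_normPotential_sub_inner_le μ hpmin
  obtain ⟨q, hq⟩ := exists_forall_normPotential_sub_inner_le ν hu1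
  refine ⟨u, p, q, hu1, hpmin, hq, ?_⟩
  rintro rfl
  refine hp ?_
  rw [(hpmin.hasFDerivAt (hdμ p)).fderiv, (IsTiltedMinimizer.hasFDerivAt (hdν p) hq).fderiv]

end QQPlot

theorem theorem2p2 {d : ℕ} (hd : 2 ≤ d)
    (F G : Measure (EuclideanSpace ℝ (Fin d)))
    [IsProbabilityMeasure F] [IsProbabilityMeasure G]
    (hF : HasPositiveLocallyBoundedDensity F) (hG : HasPositiveLocallyBoundedDensity G)
    {Ω : Type*} [MeasurableSpace Ω] (P : Measure Ω) [IsProbabilityMeasure P]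
    (X Y : ℕ → Ω → EuclideanSpace ℝ (Fin d))
    (hX : ∀ j, HasLaw (X j) F P) (hY : ∀ j, HasLaw (Y j) G P)
    (hindep : iIndepFun (Sum.elim X Y) P)
    (n m : ℕ → ℕ) (hn : Tendsto n atTop atTop) (hm : Tendsto m atTop atTop)
    (lam : ℝ) (hlam : lam ∈ Set.Ioo (0 : ℝ) 1)
    (hnm : Tendsto (fun N => (n N : ℝ) / ((n N : ℝ) + (m N : ℝ))) atTop (𝓝 lam)) :
    (∀ r ∈ Set.Ioo (0 : ℝ) 1, ∀ ε > 0,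
      Tendsto (fun N => P (⋂ i : Fin d,
          {ω | qqPlot r (fun j : Fin (n N) => X j ω) (fun j : Fin (m N) => Y j ω) i
            ⊆ lineNeighborhood ε}))
        atTop (𝓝 1)) ↔ F = G := by
  have hposF := hF.isOpenPosMeasure
  have hposG := hG.isOpenPosMeasure
  have hatomF := hF.nullSingletonClass hd
  have hatomG := hG.nullSingletonClass hd
  have hdim : 2 ≤ Module.finrank ℝ (EuclideanSpace ℝ (Fin d)) := by simpa using hd
  have hnt : Nontrivial (EuclideanSpace ℝ (Fin d)) :=
    Module.nontrivial_of_finrank_pos (R := ℝ) (by omega)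
  have hindX : Pairwise fun i j => IndepFun (X i) (X j) P := fun i j hij =>
    hindep.indepFun (i := Sum.inl i) (j := Sum.inl j) (by simpa using hij)
  have hindY : Pairwise fun i j => IndepFun (Y i) (Y j) P := fun i j hij =>
    hindep.indepFun (i := Sum.inr i) (j := Sum.inr j) (by simpa using hij)
  constructor
  · intro hqq
    by_contra hne
    obtain ⟨u, p, q, hu, hp, hq, hpq⟩ := exists_tiltedMinimizer_ne F G hne
    obtain ⟨i, hi⟩ : ∃ i, p i ≠ q i := by
      by_contra! hall
      exact hpq (PiLp.ext hall)
    -- A point in the strip has coordinates within 2ε of each other, and each is within ε of its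
    -- limit p i or q i; together these would give |q i - p i| < 4ε.
    set ε := |q i - p i| / 4 with hε_def
    have hε : 0 < ε := div_pos (abs_pos.2 (sub_ne_zero.2 (Ne.symm hi))) (by norm_num)
    set r := (1 + ‖u‖) / 2 with hr_def
    have hr : r ∈ Set.Ioo (0 : ℝ) 1 := ⟨by positivity, by linarith⟩
    have hXnear := eventually_empiricalSpatialQuantile_near hX hindX hn
      (fun p' hp' => normPotential_sub_inner_lt_of_ne hdim F hp hp') hε
    have hYnear := eventually_empiricalSpatialQuantile_near hY hindY hm
      (fun p' hp' => normPotential_sub_inner_lt_of_ne hdim G hq hp') hε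
    obtain ⟨a, ha, b, hb, hab⟩ := eventually_prod_iff.1 (hXnear.and hYnear)
    obtain ⟨η, hη, hball⟩ := Metric.eventually_nhds_iff.1 hb
    -- The first bound keeps the rank where both empirical quantiles are controlled; the second
    -- keeps its norm at most r, midway between ‖u‖ and 1.
    have hη' : 0 < min η ((1 - ‖u‖) / 2) := lt_min hη (by linarith)
    obtain ⟨ρ, hρ, htilt⟩ := exists_eventually_tilt_near
      (eventually_isProbabilityMeasure_empiricalDistribution P X hn)
      (tendsto_normPotential_empiricalDistribution hX hindX hn)
      (differentiable_normPotential F p) hp hη'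
    have hbad : ∀ᶠ z in inProbability P, ¬ z.2 ∈ ⋂ i : Fin d,
        {ω | qqPlot r (fun j : Fin (n z.1) => X j ω) (fun j : Fin (m z.1) => Y j ω) i
          ⊆ lineNeighborhood ε} := by
      filter_upwards [ha, htilt, eventually_exists_sample_near hX hindX hn p hρ] with z h1 h2 h3
      intro hmem
      obtain ⟨k, hk⟩ := h3
      set v := spatialRank (fun j : Fin (n z.1) => X j z.2) (X k z.2) with hv
      have hvu : ‖v - u‖ < min η ((1 - ‖u‖) / 2) :=
        h2 _ _ hk (isTiltedMinimizer_spatialRank _ _)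
      obtain ⟨hvX, hvY⟩ := hab h1 (hball (y := v)
        (by rw [dist_eq_norm]; exact hvu.trans_le (min_le_left _ _)))
      have hvr : ‖v‖ ≤ r := by
        have := norm_le_norm_add_norm_sub' v u
        linarith [hvu.trans_le (min_le_right _ _)]
      have hline := abs_sub_lt_of_mem_lineNeighborhood
        (Set.mem_iInter.1 hmem i ⟨Sum.inl k, by simpa [pooledRank] using hvr, rfl⟩)
      have eX := abs_lt.1 ((PiLp.norm_apply_le _ i).trans_lt hvX)
      have eY := abs_lt.1 ((PiLp.norm_apply_le _ i).trans_lt hvY)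
      simp only [PiLp.sub_apply] at eX eY
      simp only [pooledRank, Sum.elim_inl, ← hv] at hline
      have hline' := abs_lt.1 hline
      have : |q i - p i| < 4 * ε := by
        rw [abs_lt]
        constructor <;> linarith
      rw [hε_def] at this
      linarith
    rw [eventually_inProbability_iff] at hbad
    simp only [not_not] at hbad
    exact one_ne_zero (tendsto_nhds_unique (hqq r hr ε hε) hbad)
  · rintro rfl r hr ε hε
    -- Uniformity over the whole ball is essential, because the plotted levels are random and depend
    -- on the same data.
    have hgood : ∀ᶠ z in inProbability P, ∀ u ∈ Metric.closedBall (0 : EuclideanSpace ℝ (Fin d)) r,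
        ‖empiricalSpatialQuantile (fun j : Fin (m z.1) => Y j z.2) u -
          empiricalSpatialQuantile (fun j : Fin (n z.1) => X j z.2) u‖ < ε := by
      refine (isCompact_closedBall _ _).eventually_forall_of_forall_eventually_prod fun u hu => ?_
      have hu1 : ‖u‖ < 1 := (mem_closedBall_zero_iff.1 hu).trans_lt hr.2
      obtain ⟨q, hq⟩ := exists_forall_normPotential_sub_inner_le F hu1
      have hq' := fun p (hp : p ≠ q) => normPotential_sub_inner_lt_of_ne hdim F hq hp
      filter_upwards [eventually_empiricalSpatialQuantile_near hX hindX hn hq' (half_pos hε),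
        eventually_empiricalSpatialQuantile_near hY hindY hm hq' (half_pos hε)] with z hz1 hz2
      rw [norm_sub_rev] at hz1
      calc _ ≤ _ := norm_sub_le_norm_sub_add_norm_sub _ q _
        _ < ε := by linarith
    refine tendsto_measure_one_of_eventually_inProbability (p := fun z => z.2 ∈ ⋂ i : Fin d,
      {ω | qqPlot r (fun j : Fin (n z.1) => X j ω) (fun j : Fin (m z.1) => Y j ω) i
        ⊆ lineNeighborhood ε}) ?_
    filter_upwards [hgood] with z hz
    refine Set.mem_iInter.2 fun i => ?_
    rintro _ ⟨k, hk, rfl⟩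
    refine mem_lineNeighborhood_of_abs_sub_lt ?_
    exact (PiLp.norm_apply_le _ i).trans_lt (hz _ hk)
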